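/- Let $R$ be a commutative Noetherian ring and let $\Phi$ be a system of ideals of $R$, i.e. a non-empty set of ideals such that for all $\mathfrak a_1,\mathfrak a_2\in\Phi$ there is $\mathfrak b\in\Phi$ with $\mathfrak b\subseteq\mathfrak a_1\mathfrak a_2$. For an $R$-module $M$ put $\Gamma_\Phi(M)=\{x\in M\mid \mathfrak a x=0\text{ for some }\mathfrak a\in\Phi\}$, let $H^i_\Phi$ be the $i$-th right derived functor of $\Gamma_\Phi$, and for an ideal $\mathfrak a$ let $H^i_{\mathfrak a}(M)=\varinjlim_n\operatorname{Ext}^i_R(R/\mathfrak a^n,M)$ be the $i$-th local cohomology module. The dimension $\dim_R N$ of an $R$-module $N$ is the Krull dimension of its support, with $\dim 0=-1$. Let $k$ be an integer, let $\mathcal S$ be the class of all $R$-modules $N$ with $\dim_R N\le k$, let $M$ be an arbitrary $R$-module and let $t\ge 0$ be an integer. Then the following are equivalent: (i) $H^i_\Phi(M)\in\mathcal S$ for all $i<t$; (ii) $H^i_{\mathfrak a}(M)\in\mathcal S$ for all $i<t$ and all $\mathfrak a\in\Phi$. Likewise, $H^i_\Phi(M)\in\mathcal S$ for all $i\ge 0$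 if and only if $H^i_{\mathfrak a}(M)\in\mathcal S$ for all $i\ge 0$ and all $\mathfrak a\in\Phi$. -/

import Mathlib

open CategoryTheory

universe u

/-- A system of ideals of `R`: a non-empty set `Φ` of ideals such that any product `𝔞 * 𝔟` of two
members contains a member. -/
structure SystemOfIdeals (R : Type u) [CommRing R] where
  carrier : Set (Ideal R)
  nonempty : carrier.Nonempty
  exists_le_mul : ∀ 𝔞 ∈ carrier, ∀ 𝔟 ∈ carrier, ∃ 𝔠 ∈ carrier, 𝔠 ≤ 𝔞 * 𝔟

namespace SystemOfIdeals

variable {R : Type u} [CommRing R]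

instance : Membership (Ideal R) (SystemOfIdeals R) := ⟨fun Φ 𝔞 => 𝔞 ∈ Φ.carrier⟩

/-- `Γ_Φ(M) = {x ∈ M | 𝔞 x = 0 for some 𝔞 ∈ Φ}`, as a submodule of `M`. -/
def torsion (Φ : SystemOfIdeals R) (M : Type u) [AddCommGroup M] [Module R M] :
    Submodule R M where
  carrier := {x | ∃ 𝔞 ∈ Φ, ∀ r ∈ 𝔞, r • x = 0}
  zero_mem' := by
    obtain ⟨𝔞, h𝔞⟩ := Φ.nonempty
    exact ⟨𝔞, h𝔞, fun r _ => smul_zero r⟩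
  add_mem' := by
    rintro x y ⟨𝔞, h𝔞, hx⟩ ⟨𝔟, h𝔟, hy⟩
    obtain ⟨𝔠, h𝔠, hle⟩ := Φ.exists_le_mul 𝔞 h𝔞 𝔟 h𝔟
    refine ⟨𝔠, h𝔠, fun r hr => ?_⟩
    have hr' : r ∈ 𝔞 ⊓ 𝔟 := Ideal.mul_le_inf (hle hr)
    rw [smul_add, hx r hr'.1, hy r hr'.2, add_zero]
  smul_mem' := by
    rintro s x ⟨𝔞, h𝔞, hx⟩
    exact ⟨𝔞, h𝔞, fun r hr => by rw [smul_comm, hx r hr, smul_zero]⟩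

theorem map_mem_torsion (Φ : SystemOfIdeals R) {M N : Type u} [AddCommGroup M] [Module R M]
    [AddCommGroup N] [Module R N] (f : M →ₗ[R] N) :
    ∀ x ∈ Φ.torsion M, f x ∈ Φ.torsion N := by
  rintro x ⟨𝔞, h𝔞, hx⟩
  exact ⟨𝔞, h𝔞, fun r hr => by rw [← map_smul, hx r hr, map_zero]⟩

/-- The functor `Γ_Φ` on `R`-modules; a morphism is sent to its restriction. -/
def torsionFunctor (Φ : SystemOfIdeals R) : ModuleCat.{u} R ⥤ ModuleCat.{u} R where
  obj M := ModuleCat.of R (Φ.torsion M)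
  map f := ModuleCat.ofHom (f.hom.restrict (Φ.map_mem_torsion f.hom))

instance (Φ : SystemOfIdeals R) : Φ.torsionFunctor.Additive where

/-- The general local cohomology functor `H^i_Φ`: the `i`-th right derived functor of `Γ_Φ`. -/
noncomputable def localCohomology (Φ : SystemOfIdeals R) (i : ℕ) :
    ModuleCat.{u} R ⥤ ModuleCat.{u} R :=
  Φ.torsionFunctor.rightDerived i

end SystemOfIdeals

/-- The Krull dimension of (the support of) an `R`-module, as an integer or `⊤`,
with the convention `dim 0 = -1`. -/
noncomputable def moduleDim (R : Type u) [CommRing R] (N : Type u) [AddCommGroup N] [Module R N] :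
    WithTop ℤ :=
  match Module.supportDim R N with
  | ⊥ => ((-1 : ℤ) : WithTop ℤ)
  | (n : ℕ∞) => n.map (fun m : ℕ => (m : ℤ))

/-- The class of all `R`-modules `N` with `dim N ≤ k`. -/
def dimLE (R : Type u) [CommRing R] (k : ℤ) : ObjectProperty (ModuleCat.{u} R) :=
  fun N => moduleDim R N ≤ (k : WithTop ℤ)

/-!
The modules of dimension at most `k` are the torsion modules of a system of ideals `Ψ`, namely of
the ideals whose zero locus consists of primes of coheight at most `k`. So one compares the
`Ψ`-torsion of `H^i_Φ(M)` with that of `H^i_𝔞(M)` for all `𝔞 ∈ Φ`, by induction on the range of `i`.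
In degree zero, `Γ_Φ(M)` is the sum of the `Γ_𝔞(M)`. If `Γ_Φ(M)` is `Ψ`-torsion and `E` is an
injective module containing `M`, then `M` embeds into `Γ_Ψ(E) × E / Γ_Φ(E)`. Over a Noetherian ring
this product is injective and its `Φ`-torsion is `Ψ`-torsion, so up to `Ψ`-torsion modules, passing
to the cokernel of the embedding shifts the degree by one for all the cohomology functors.
-/

open Limits

theorem exists_extension_le_ker {R : Type*} [Ring R] {M E : Type u} [AddCommGroup M] [Module R M]
    [AddCommGroup E] [Module R E] [Module.Injective R E] {N K : Submodule R M} (f : N →ₗ[R] E)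
    (hf : K.comap N.subtype ≤ LinearMap.ker f) :
    ∃ g : M →ₗ[R] E, K ≤ LinearMap.ker g ∧ ∀ x : N, g x = f x := by
  let i : (N ⧸ K.comap N.subtype) →ₗ[R] M ⧸ K := Submodule.mapQ _ K N.subtype le_rfl
  have hi : Function.Injective i := by
    rw [← LinearMap.ker_eq_bot, Submodule.ker_mapQ, Submodule.mkQ_map_self]
  obtain ⟨g, hg⟩ := Module.Injective.out i hi (Submodule.liftQ _ f hf)
  exact ⟨g ∘ₗ K.mkQ, K.ker_mkQ.ge.trans (LinearMap.ker_le_ker_comp _ _),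
    fun x => hg (Submodule.Quotient.mk x)⟩

theorem injective_quotient_of_injective {R : Type*} [Ring R] {E : Type u} [AddCommGroup E]
    [Module R E] [Module.Injective R E] (N : Submodule R E) [Module.Injective R N] :
    Module.Injective R (E ⧸ N) := by
  obtain ⟨ρ, hρ⟩ := Module.Injective.out N.subtype N.injective_subtype LinearMap.id
  let s : (E ⧸ N) →ₗ[R] E := N.liftQ (LinearMap.id - N.subtype ∘ₗ ρ) fun x hx => by
    simpa [sub_eq_zero] using congrArg Subtype.val (hρ ⟨x, hx⟩).symm
  have hs (x : E ⧸ N) : N.mkQ (s x) = x := by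
    obtain ⟨x, rfl⟩ := N.mkQ_surjective x
    simp [s]
  refine ⟨fun X Y _ _ _ _ f hf g => ?_⟩
  obtain ⟨h, hh⟩ := Module.Injective.out f hf (s ∘ₗ g)
  exact ⟨N.mkQ ∘ₗ h, fun x => by rw [LinearMap.comp_apply, hh, LinearMap.comp_apply, hs]⟩

theorem injective_prod {R : Type*} [Ring R] {E J : Type u} [AddCommGroup E] [Module R E]
    [AddCommGroup J] [Module R J] [Module.Injective R E] [Module.Injective R J] :
    Module.Injective R (E × J) where
  out _ _ _ _ _ _ f hf g := by
    obtain ⟨l, hl⟩ := Module.Injective.out f hf (LinearMap.fst R E J ∘ₗ g)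
    obtain ⟨m, hm⟩ := Module.Injective.out f hf (LinearMap.snd R E J ∘ₗ g)
    exact ⟨l.prod m, fun x => Prod.ext (hl x) (hm x)⟩

theorem exists_comap_pow_smul_top_le_ker {R : Type*} [CommRing R] [IsNoetherianRing R]
    {M P : Type*} [AddCommGroup M] [Module R M] [Module.Finite R M] [AddCommGroup P] [Module R P]
    {𝔞 : Ideal R} {N : Submodule R M} (f : N →ₗ[R] P)
    (h𝔞 : 𝔞 ≤ (LinearMap.range f).annihilator) :
    ∃ n, (𝔞 ^ n • (⊤ : Submodule R M)).comap N.subtype ≤ LinearMap.ker f := by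
  obtain ⟨k, hk⟩ := Ideal.exists_pow_inf_eq_pow_smul 𝔞 N
  have h_artin_rees : 𝔞 ^ (k + 1) • ⊤ ⊓ N ≤ 𝔞 • N := by
    rw [hk (k + 1) k.le_succ, Nat.add_sub_cancel_left, pow_one]
    exact Submodule.smul_mono le_rfl inf_le_right
  have h_smul_top : 𝔞 • (⊤ : Submodule R N) ≤ LinearMap.ker f := by
    refine Submodule.smul_le.2 fun r hr x _ => ?_
    rw [LinearMap.mem_ker, map_smul]
    exact Submodule.mem_annihilator.1 (h𝔞 hr) _ ⟨x, rfl⟩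
  exact ⟨k + 1, fun x hx => h_smul_top <|
    (Submodule.mem_smul_top_iff 𝔞 N x).2 (h_artin_rees ⟨hx, x.2⟩)⟩

namespace SystemOfIdeals

variable {R : Type u} [CommRing R]

/-- The system of the powers of an ideal, for which `Γ_Φ` is the usual `𝔞`-torsion functor. -/
def powers (𝔞 : Ideal R) : SystemOfIdeals R where
  carrier := Set.range (𝔞 ^ · : ℕ → Ideal R)
  nonempty := Set.range_nonempty _
  exists_le_mul := by
    rintro _ ⟨m, rfl⟩ _ ⟨n, rfl⟩
    exact ⟨𝔞 ^ (m + n), ⟨m + n, rfl⟩, (pow_add 𝔞 m n).le⟩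

variable (Φ Ψ : SystemOfIdeals R) {M N : Type u} [AddCommGroup M] [Module R M]
  [AddCommGroup N] [Module R N]

theorem exists_le_pow {𝔞 : Ideal R} (h𝔞 : 𝔞 ∈ Φ) (n : ℕ) : ∃ 𝔟 ∈ Φ, 𝔟 ≤ 𝔞 ^ n := by
  induction n with
  | zero => exact ⟨𝔞, h𝔞, by simp⟩
  | succ n ih =>
    obtain ⟨𝔟, h𝔟, hle⟩ := ih
    obtain ⟨𝔠, h𝔠, hle'⟩ := Φ.exists_le_mul 𝔟 h𝔟 𝔞 h𝔞
    exact ⟨𝔠, h𝔠, hle'.trans (by rw [pow_succ]; exact Ideal.mul_mono_left hle)⟩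

variable (M) in
theorem torsion_eq_iSup_powers : Φ.torsion M = ⨆ 𝔞 ∈ Φ, (powers 𝔞).torsion M := by
  refine le_antisymm ?_ (iSup₂_le ?_)
  · rintro x ⟨𝔞, h𝔞, hx⟩
    exact le_iSup₂ (f := fun 𝔞 (_ : 𝔞 ∈ Φ) => (powers 𝔞).torsion M) 𝔞 h𝔞
      ⟨𝔞, ⟨1, pow_one 𝔞⟩, hx⟩
  · rintro 𝔞 h𝔞 x ⟨_, ⟨n, rfl⟩, hx⟩
    obtain ⟨𝔟, h𝔟, hle⟩ := Φ.exists_le_pow h𝔞 n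
    exact ⟨𝔟, h𝔟, fun r hr => hx r (hle hr)⟩

variable {Φ}

theorem map_mem_torsion_iff_of_injective {f : M →ₗ[R] N} (hf : Function.Injective f) {x : M} :
    f x ∈ Φ.torsion N ↔ x ∈ Φ.torsion M :=
  ⟨fun ⟨𝔞, h𝔞, hx⟩ => ⟨𝔞, h𝔞, fun r hr => hf (by rw [map_smul, hx r hr, map_zero])⟩,
    Φ.map_mem_torsion f x⟩

theorem exists_le_annihilator_of_fg {K : Submodule R M} (hK : K.FG) (hle : K ≤ Φ.torsion M) :
    ∃ 𝔞 ∈ Φ, 𝔞 ≤ K.annihilator := by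
  induction K, hK using Submodule.fg_induction with
  | singleton x =>
    obtain ⟨𝔞, h𝔞, hx⟩ := hle (Submodule.mem_span_singleton_self x)
    exact ⟨𝔞, h𝔞, fun r hr => (Submodule.mem_annihilator_span_singleton x r).2 (hx r hr)⟩
  | sup K₁ K₂ _ _ h₁ h₂ =>
    obtain ⟨𝔞, h𝔞, hK₁⟩ := h₁ (le_sup_left.trans hle)
    obtain ⟨𝔟, h𝔟, hK₂⟩ := h₂ (le_sup_right.trans hle)
    obtain ⟨𝔠, h𝔠, h𝔠le⟩ := Φ.exists_le_mul 𝔞 h𝔞 𝔟 h𝔟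
    rw [Submodule.annihilator_sup]
    exact ⟨𝔠, h𝔠, h𝔠le.trans (Ideal.mul_le_inf.trans (inf_le_inf hK₁ hK₂))⟩

theorem mem_torsion_of_smul_mem [IsNoetherianRing R] {𝔞 : Ideal R} (h𝔞 : 𝔞 ∈ Φ) {x : M}
    (hx : ∀ r ∈ 𝔞, r • x ∈ Φ.torsion M) : x ∈ Φ.torsion M := by
  obtain ⟨𝔟, h𝔟, hle⟩ : ∃ 𝔟 ∈ Φ, 𝔟 ≤
      (Submodule.map (LinearMap.toSpanSingleton R M x) 𝔞).annihilator :=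
    exists_le_annihilator_of_fg ((IsNoetherian.noetherian 𝔞).map _)
      (Submodule.map_le_iff_le_comap.2 hx)
  obtain ⟨𝔠, h𝔠, h𝔠le⟩ := Φ.exists_le_mul 𝔟 h𝔟 𝔞 h𝔞
  have hmul : 𝔟 * 𝔞 ≤ LinearMap.ker (LinearMap.toSpanSingleton R M x) :=
    Ideal.mul_le.2 fun s hs t ht =>
      (mul_smul s t x).trans (Submodule.mem_annihilator.1 (hle hs) _ ⟨t, ht, rfl⟩)
  exact ⟨𝔠, h𝔠, fun r hr => hmul (h𝔠le hr)⟩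

variable (Φ)

variable (M) in
theorem torsion_quotient_torsion [IsNoetherianRing R] : Φ.torsion (M ⧸ Φ.torsion M) = ⊥ := by
  rw [eq_bot_iff]
  rintro x ⟨𝔞, h𝔞, hx⟩
  obtain ⟨x, rfl⟩ := (Φ.torsion M).mkQ_surjective x
  exact (Submodule.Quotient.mk_eq_zero _).2 (mem_torsion_of_smul_mem h𝔞 fun r hr =>
    (Submodule.Quotient.mk_eq_zero _).1 (hx r hr))

instance injective_torsion [IsNoetherianRing R] (E : Type u) [AddCommGroup E] [Module R E]
    [Module.Injective R E] : Module.Injective R (Φ.torsion E) := by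
  refine Module.Baer.injective fun I g => ?_
  let f : I →ₗ[R] E := (Φ.torsion E).subtype ∘ₗ g
  obtain ⟨𝔞, h𝔞, hf⟩ : ∃ 𝔞 ∈ Φ, 𝔞 ≤ (LinearMap.range f).annihilator :=
    exists_le_annihilator_of_fg (Module.Finite.iff_fg.1 (Module.Finite.range f))
      (by rintro _ ⟨x, rfl⟩; exact (g x).2)
  obtain ⟨n, hn⟩ := exists_comap_pow_smul_top_le_ker f hf
  obtain ⟨h, hker, hext⟩ := exists_extension_le_ker f hn
  have h_torsion (r : R) : h r ∈ Φ.torsion E := by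
    obtain ⟨𝔟, h𝔟, hle⟩ := Φ.exists_le_pow h𝔞 n
    refine ⟨𝔟, h𝔟, fun s hs => ?_⟩
    rw [← map_smul]
    exact hker (Submodule.smul_mem_smul (hle hs) trivial)
  exact ⟨h.codRestrict _ h_torsion, fun x hx => Subtype.ext (hext ⟨x, hx⟩)⟩

variable {Φ Ψ}

theorem exists_mono_injective_torsion_le [IsNoetherianRing R] {M : ModuleCat.{u} R}
    (hM : Φ.torsion M ≤ Ψ.torsion M) :
    ∃ (E : ModuleCat.{u} R) (f : M ⟶ E), Mono f ∧ Injective E ∧ Φ.torsion E ≤ Ψ.torsion E := by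
  let E := Injective.under M
  let i : M →ₗ[R] E := (Injective.ι M).hom
  have hi : Function.Injective i := (ModuleCat.mono_iff_injective (Injective.ι M)).1 inferInstance
  have : Module.Injective R E :=
    (Module.injective_iff_injective_object R E).2 (Injective.injective_under M)
  have := injective_quotient_of_injective (Φ.torsion E)
  obtain ⟨ρ, hρ⟩ := Module.Injective.out (Ψ.torsion E).subtype Subtype.val_injective LinearMap.id
  let f : M →ₗ[R] Ψ.torsion E × (E ⧸ Φ.torsion E) := (ρ.prod (Φ.torsion E).mkQ) ∘ₗ i
  have hf : Function.Injective f := by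
    refine (injective_iff_map_eq_zero f).2 fun x hx => ?_
    obtain ⟨hρx, hxΦ⟩ := Prod.ext_iff.1 hx
    have hxΨ : i x ∈ Ψ.torsion E := Ψ.map_mem_torsion i x <| hM <|
      (map_mem_torsion_iff_of_injective hi).1 ((Submodule.Quotient.mk_eq_zero _).1 hxΦ)
    have : (⟨i x, hxΨ⟩ : Ψ.torsion E) = 0 := (hρ ⟨i x, hxΨ⟩).symm.trans hρx
    exact hi ((congrArg Subtype.val this).trans (map_zero i).symm)
  refine ⟨ModuleCat.of R (Ψ.torsion E × (E ⧸ Φ.torsion E)), ModuleCat.ofHom f,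
    (ModuleCat.mono_iff_injective _).2 hf, ?_, ?_⟩
  · exact (Module.injective_iff_injective_object R _).1 injective_prod
  · rintro ⟨⟨x, 𝔞, h𝔞, hx⟩, y⟩ hxy
    have hy : y ∈ Φ.torsion (E ⧸ Φ.torsion E) := Φ.map_mem_torsion (LinearMap.snd R _ _) _ hxy
    obtain rfl : y = 0 := by rwa [torsion_quotient_torsion, Submodule.mem_bot] at hy
    exact ⟨𝔞, h𝔞, fun r hr => Prod.ext (Subtype.ext (hx r hr)) (smul_zero r)⟩

/-- The class of `Φ`-torsion modules. -/
def torsionModules (Φ : SystemOfIdeals R) : ObjectProperty (ModuleCat.{u} R) :=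
  fun N => Φ.torsion N = ⊤

theorem torsionModules_iff {N : ModuleCat.{u} R} :
    Φ.torsionModules N ↔ ∀ x : N, x ∈ Φ.torsion N :=
  Submodule.eq_top_iff'

instance [IsNoetherianRing R] : Φ.torsionModules.IsSerreClass where
  exists_zero := ⟨ModuleCat.of R PUnit, ModuleCat.isZero_of_subsingleton _,
    torsionModules_iff.2 fun x => by rw [Subsingleton.elim x 0]; exact zero_mem _⟩
  prop_of_mono f _ hN := torsionModules_iff.2 fun x =>
    (map_mem_torsion_iff_of_injective ((ModuleCat.mono_iff_injective f).1 ‹_›)).1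
      (torsionModules_iff.1 hN (f.hom x))
  prop_of_epi f _ hM := torsionModules_iff.2 fun x => by
    obtain ⟨x, rfl⟩ := (ModuleCat.epi_iff_surjective f).1 ‹_› x
    exact Φ.map_mem_torsion f.hom x (torsionModules_iff.1 hM x)
  prop_X₂_of_shortExact {S} hS h₁ h₃ := torsionModules_iff.2 fun x => by
    obtain ⟨𝔞, h𝔞, hx⟩ := torsionModules_iff.1 h₃ (S.g.hom x)
    refine mem_torsion_of_smul_mem h𝔞 fun r hr => ?_
    obtain ⟨y, hy⟩ := (ShortComplex.moduleCat_exact_iff S).1 hS.exact (r • x)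
      (by rw [map_smul]; exact hx r hr)
    rw [← hy]
    exact Φ.map_mem_torsion S.f.hom y (torsionModules_iff.1 h₁ y)

theorem torsionModules_torsionFunctor_obj_iff {M : ModuleCat.{u} R} :
    Ψ.torsionModules (Φ.torsionFunctor.obj M) ↔ Φ.torsion M ≤ Ψ.torsion M := by
  rw [torsionModules_iff]
  exact Subtype.forall.trans (forall₂_congr fun x hx =>
    (map_mem_torsion_iff_of_injective (f := (Φ.torsion M).subtype) Subtype.val_injective).symm)

variable (Φ) in
instance : Limits.PreservesFiniteLimits Φ.torsionFunctor := by
  refine (Φ.torsionFunctor.preservesFiniteLimits_tfae.out 0 3).1 fun S hS => ?_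
  have hf : Function.Injective S.f.hom := (ModuleCat.mono_iff_injective _).1 hS.mono_f
  refine ⟨(ShortComplex.moduleCat_exact_iff _).2 ?_, (ModuleCat.mono_iff_injective _).2 ?_⟩
  · rintro ⟨x, hx⟩ hgx
    obtain ⟨y, rfl⟩ := (ShortComplex.moduleCat_exact_iff _).1 hS.exact x (congrArg Subtype.val hgx)
    exact ⟨⟨y, (map_mem_torsion_iff_of_injective hf).1 hx⟩, rfl⟩
  · exact fun x y hxy => Subtype.ext (hf (congrArg Subtype.val hxy))

/-- The system of all ideals whose zero locus is contained in `T`; its torsion modules are the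
modules supported in `T`. -/
def ofZeroLocus (T : Set (PrimeSpectrum R)) : SystemOfIdeals R where
  carrier := {𝔞 | PrimeSpectrum.zeroLocus (𝔞 : Set R) ⊆ T}
  nonempty := ⟨⊤, by simp⟩
  exists_le_mul 𝔞 h𝔞 𝔟 h𝔟 :=
    ⟨𝔞 * 𝔟, (PrimeSpectrum.zeroLocus_mul 𝔞 𝔟).trans_subset (Set.union_subset h𝔞 h𝔟), le_rfl⟩

theorem torsionModules_ofZeroLocus_iff {T : Set (PrimeSpectrum R)} {N : ModuleCat.{u} R} :
    (ofZeroLocus T).torsionModules N ↔ Module.support R N ⊆ T := by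
  rw [torsionModules_iff]
  constructor
  · intro h p hp
    obtain ⟨x, hx⟩ := Module.mem_support_iff'.1 hp
    obtain ⟨𝔞, h𝔞, h𝔞x⟩ := h x
    exact h𝔞 fun r hr => by_contra fun hrp => hx r hrp (h𝔞x r hr)
  · intro h x
    refine ⟨LinearMap.ker (LinearMap.toSpanSingleton R N x), fun p hp => h ?_, fun r hr => hr⟩
    exact Module.mem_support_iff'.2 ⟨x, fun r hrp hrx => hrp (hp hrx)⟩

end SystemOfIdeals

theorem coheight_le_supportDim {R : Type*} [CommRing R] {N : Type*} [AddCommGroup N] [Module R N]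
    {p : PrimeSpectrum R} (hp : p ∈ Module.support R N) :
    Order.coheight p ≤ Module.supportDim R N := by
  rw [Order.coheight_eq_krullDim_Ici]
  exact Order.krullDim_le_of_strictMono (fun q => ⟨q.1, Module.mem_support_mono q.2 hp⟩)
    fun _ _ hlt => hlt

theorem supportDim_lt_iff_coheight_lt {R : Type*} [CommRing R] {N : Type*} [AddCommGroup N]
    [Module R N] {n : ℕ} :
    Module.supportDim R N < n ↔ ∀ p ∈ Module.support R N, Order.coheight p < n := by
  refine ⟨fun h p hp => by exact_mod_cast (coheight_le_supportDim hp).trans_lt h, fun h => ?_⟩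
  obtain hs | ⟨p, hp⟩ := (Module.support R N).eq_empty_or_nonempty
  · rw [Module.support_eq_empty_iff] at hs
    rw [Module.supportDim_eq_bot_of_subsingleton]
    exact WithBot.bot_lt_coe _
  · cases n with
    | zero => exact absurd (h p hp) not_lt_zero
    | succ n =>
      refine lt_of_le_of_lt (b := ((n : ℕ∞) : WithBot ℕ∞)) ?_ (by exact_mod_cast n.lt_succ_self)
      rw [Module.supportDim, Order.krullDim_eq_iSup_coheight]
      refine iSup_le fun p => WithBot.coe_le_coe.2 ?_
      exact (Order.coheight_le_coheight_apply_of_strictMono Subtype.val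
        (fun _ _ hlt => hlt) p).trans (Order.le_of_lt_add_one (by exact_mod_cast h p p.2))

theorem dimLE_iff_supportDim_lt {R : Type u} [CommRing R] {k : ℤ} {N : ModuleCat.{u} R} :
    dimLE R k N ↔ -1 ≤ k ∧ Module.supportDim R N < ((k + 1).toNat : ℕ) := by
  rw [dimLE, moduleDim]
  cases Module.supportDim R N with
  | bot =>
    have h_bot : (⊥ : WithBot ℕ∞) < ((k + 1).toNat : ℕ) := WithBot.bot_lt_coe _
    exact WithTop.coe_le_coe.trans (iff_self_and.2 fun _ => h_bot)
  | coe n =>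
    cases n with
    | top =>
      refine iff_of_false (WithTop.not_top_le_coe k) fun h => ?_
      exact absurd h.2 (by exact_mod_cast not_top_lt)
    | coe n =>
      change ((n : ℤ) : WithTop ℤ) ≤ k ↔ _
      have h_lt : ((n : ℕ∞) : WithBot ℕ∞) < ((k + 1).toNat : ℕ) ↔ n < (k + 1).toNat := by
        norm_cast
      rw [WithTop.coe_le_coe, h_lt]
      omega

theorem dimLE_iff_torsionModules {R : Type u} [CommRing R] {k : ℤ} {N : ModuleCat.{u} R} :
    dimLE R k N ↔ -1 ≤ k ∧
      (SystemOfIdeals.ofZeroLocus {p | Order.coheight p < (k + 1).toNat}).torsionModules N := by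
  rw [dimLE_iff_supportDim_lt, supportDim_lt_iff_coheight_lt,
    SystemOfIdeals.torsionModules_ofZeroLocus_iff]
  rfl

section DimensionShifting

variable {C D A : Type*} [Category* C] [Category* D] [Category* A] [Abelian C] [Abelian D]
  [Abelian A]

/-- A sequence of functors `Tⁿ` admits dimension shifting if `Tⁿ⁺¹` vanishes on injective objects
and `Tⁿ⁺¹(X₁)` is the cokernel of `Tⁿ(X₂) ⟶ Tⁿ(X₃)` for all short exact sequences
`0 ⟶ X₁ ⟶ X₂ ⟶ X₃ ⟶ 0` with `X₂` injective. -/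
structure IsDimensionShifting (T : ℕ → C ⥤ D) : Prop where
  isZero_succ (n : ℕ) (X : C) [Injective X] : IsZero ((T (n + 1)).obj X)
  nonempty_cokernel_iso {S : ShortComplex C} (hS : S.ShortExact) [Injective S.X₂] (n : ℕ) :
    Nonempty (cokernel ((T n).map S.g) ≅ (T (n + 1)).obj S.X₁)

namespace IsDimensionShifting

variable {T T' : ℕ → C ⥤ D} (hT : IsDimensionShifting T)

include hT

theorem of_iso (e : ∀ n, T n ≅ T' n) : IsDimensionShifting T' where
  isZero_succ n X _ := (hT.isZero_succ n X).of_iso ((e (n + 1)).symm.app X)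
  nonempty_cokernel_iso {S} hS _ n := (hT.nonempty_cokernel_iso hS n).map fun i =>
    cokernel.mapIso _ _ ((e n).symm.app S.X₂) ((e n).symm.app S.X₃)
      ((e n).inv.naturality S.g) ≪≫ i ≪≫ (e (n + 1)).app S.X₁

theorem comp (G : D ⥤ A) [PreservesFiniteColimits G] :
    IsDimensionShifting fun n => T n ⋙ G where
  isZero_succ n X _ :=
    have := G.preservesZeroMorphisms_of_preserves_initial_object
    G.map_isZero (hT.isZero_succ n X)
  nonempty_cokernel_iso hS _ n :=
    have := G.preservesZeroMorphisms_of_preserves_initial_object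
    (hT.nonempty_cokernel_iso hS n).map fun i => (PreservesCokernel.iso G _).symm ≪≫ G.mapIso i

variable {P : ObjectProperty D} [P.IsSerreClass]

theorem prop_succ_iff {S : ShortComplex C} (hS : S.ShortExact) [Injective S.X₂]
    (h₂ : P ((T 0).obj S.X₂)) (n : ℕ) : P ((T (n + 1)).obj S.X₁) ↔ P ((T n).obj S.X₃) := by
  have hn : P ((T n).obj S.X₂) := match n with
    | 0 => h₂
    | n + 1 => P.prop_of_isZero (hT.isZero_succ n S.X₂)
  obtain ⟨e⟩ := hT.nonempty_cokernel_iso hS n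
  rw [← P.prop_iff_of_iso e]
  exact ⟨P.prop_X₂_of_exact (ShortComplex.exact_cokernel ((T n).map S.g)) hn,
    P.prop_of_epi (cokernel.π _)⟩

theorem forall_lt_prop_iff {ι : Type*} {T' : ι → ℕ → C ⥤ D}
    (hT' : ∀ j, IsDimensionShifting (T' j))
    (h_zero : ∀ X, P ((T 0).obj X) ↔ ∀ j, P ((T' j 0).obj X))
    (h_mono : ∀ X, P ((T 0).obj X) →
      ∃ (E : C) (f : X ⟶ E), Mono f ∧ Injective E ∧ P ((T 0).obj E)) (t : ℕ) (X : C) :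
    (∀ i < t, P ((T i).obj X)) ↔ ∀ i < t, ∀ j, P ((T' j i).obj X) := by
  induction t generalizing X with
  | zero => simp only [Nat.not_lt_zero, false_imp_iff, implies_true]
  | succ t ih =>
    rw [Nat.forall_lt_succ_left, Nat.forall_lt_succ_left, ← h_zero]
    refine and_congr_right fun hX => ?_
    obtain ⟨E, f, _, hE, hPE⟩ := h_mono X hX
    let S := ShortComplex.mk f (cokernel.π f) (cokernel.condition f)
    have hS : S.ShortExact := { exact := ShortComplex.exact_cokernel f }
    have : Injective S.X₂ := hE
    have h_shift (i : ℕ) : P ((T (i + 1)).obj X) ↔ P ((T i).obj (cokernel f)) :=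
      hT.prop_succ_iff hS hPE i
    have h_shift' (i : ℕ) (j : ι) :
        P ((T' j (i + 1)).obj X) ↔ P ((T' j i).obj (cokernel f)) :=
      (hT' j).prop_succ_iff hS ((h_zero E).1 hPE j) i
    simp only [h_shift, h_shift', ih]

end IsDimensionShifting

end DimensionShifting

section RightDerived

variable {C D : Type*} [Category* C] [Category* D] [Abelian C] [Abelian D]

/-- The first map `X ⟶ J⁰` of an injective resolution `J` of `X`. -/
def resolutionι {X : C} (J : InjectiveResolution X) : X ⟶ J.cocomplex.X 0 := J.ι.f 0

instance {X : C} (J : InjectiveResolution X) : Mono (resolutionι J) :=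
  inferInstanceAs (Mono (J.ι.f 0))

theorem resolutionι_comp_d {X : C} (J : InjectiveResolution X) :
    resolutionι J ≫ J.cocomplex.d 0 1 = 0 :=
  J.ι_f_zero_comp_complex_d

theorem exact_resolutionι {X : C} (J : InjectiveResolution X) :
    (ShortComplex.mk (resolutionι J) (J.cocomplex.d 0 1) (resolutionι_comp_d J)).Exact :=
  J.exact₀

variable {S : ShortComplex C} (J : InjectiveResolution S.X₃)

theorem g_comp_resolutionι_comp_d : (S.g ≫ resolutionι J) ≫ J.cocomplex.d 0 1 = 0 := by
  rw [Category.assoc, resolutionι_comp_d, comp_zero]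

theorem f_comp_g_comp_resolutionι : S.f ≫ S.g ≫ resolutionι J = 0 := by
  rw [S.zero_assoc, zero_comp]

/-- The cochain complex `X₂ ⟶ J⁰ ⟶ J¹ ⟶ ⋯` obtained from a short complex `X₁ ⟶ X₂ ⟶ X₃` and an
injective resolution `J` of `X₃`. -/
noncomputable def spliceCocomplex : CochainComplex C ℕ :=
  J.cocomplex.augment (S.g ≫ resolutionι J) (g_comp_resolutionι_comp_d J)

variable (hS : S.ShortExact)

include hS in
theorem exact_splice_zero :
    (ShortComplex.mk S.f (S.g ≫ resolutionι J) (f_comp_g_comp_resolutionι J)).Exact := by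
  let α : S ⟶ ShortComplex.mk S.f (S.g ≫ resolutionι J) (f_comp_g_comp_resolutionι J) :=
    { τ₁ := 𝟙 _, τ₂ := 𝟙 _, τ₃ := resolutionι J }
  have : Mono α.τ₃ := inferInstanceAs (Mono (resolutionι J))
  have : IsIso α.τ₂ := inferInstanceAs (IsIso (𝟙 _))
  have : Epi α.τ₁ := inferInstanceAs (Epi (𝟙 _))
  exact (ShortComplex.exact_iff_of_epi_of_isIso_of_mono α).1 hS.exact

include hS in
theorem exact_splice_one : (ShortComplex.mk (S.g ≫ resolutionι J) (J.cocomplex.d 0 1)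
    (g_comp_resolutionι_comp_d J)).Exact := by
  let α : ShortComplex.mk (S.g ≫ resolutionι J) (J.cocomplex.d 0 1)
      (g_comp_resolutionι_comp_d J) ⟶
      ShortComplex.mk (resolutionι J) (J.cocomplex.d 0 1) (resolutionι_comp_d J) :=
    { τ₁ := S.g, τ₂ := 𝟙 _, τ₃ := 𝟙 _ }
  have : Epi α.τ₁ := hS.epi_g
  have : IsIso α.τ₂ := inferInstanceAs (IsIso (𝟙 _))
  have : Mono α.τ₃ := inferInstanceAs (Mono (𝟙 _))
  exact (ShortComplex.exact_iff_of_epi_of_isIso_of_mono α).2 (exact_resolutionι J)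

include hS in
theorem exactAt_spliceCocomplex_succ (n : ℕ) : (spliceCocomplex J).ExactAt (n + 1) := by
  rw [HomologicalComplex.exactAt_iff' _ n (n + 1) (n + 2) (by simp) (by simp)]
  match n with
  | 0 => exact exact_splice_one J hS
  | n + 1 => exact J.exact_succ n

/-- The injective resolution `X₂ ⟶ J⁰ ⟶ J¹ ⟶ ⋯` of `X₁` obtained from a short exact sequence
`0 ⟶ X₁ ⟶ X₂ ⟶ X₃ ⟶ 0` with `X₂` injective and an injective resolution `J` of `X₃`. -/
noncomputable def spliceResolution [Injective S.X₂] : InjectiveResolution S.X₁ where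
  cocomplex := spliceCocomplex J
  injective
    | 0 => inferInstanceAs (Injective S.X₂)
    | n + 1 => J.injective n
  ι := (CochainComplex.fromSingle₀Equiv _ _).symm ⟨S.f, f_comp_g_comp_resolutionι J⟩
  quasiIso.quasiIsoAt
    | 0 => by
      rw [CochainComplex.quasiIsoAt₀_iff, ShortComplex.quasiIso_iff_of_zeros]
      · refine (ShortComplex.exact_and_mono_f_iff_of_iso ?_).2
          ⟨exact_splice_zero J hS, hS.mono_f⟩
        have h_comm : S.f = ((CochainComplex.fromSingle₀Equiv (spliceCocomplex J) S.X₁).symm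
            ⟨S.f, f_comp_g_comp_resolutionι J⟩).f 0 :=
          (CochainComplex.fromSingle₀Equiv_symm_apply_f_zero (C := spliceCocomplex J) S.f _).symm
        exact ShortComplex.isoMk (Iso.refl _) (Iso.refl _) (Iso.refl _)
          ((Category.id_comp S.f).trans (h_comm.trans (Category.comp_id _).symm))
          ((Category.id_comp (S.g ≫ resolutionι J)).trans (Category.comp_id _).symm)
      all_goals rfl
    | n + 1 => by
      rw [quasiIsoAt_iff_exactAt _ _ (CochainComplex.exactAt_succ_single_obj _ n)]
      exact exactAt_spliceCocomplex_succ J hS n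

variable [HasInjectiveResolutions C] (F : C ⥤ D) [F.Additive] [Injective S.X₂]

include hS in
theorem nonempty_rightDerived_succ_succ_iso (n : ℕ) :
    Nonempty ((F.rightDerived (n + 1)).obj S.X₃ ≅ (F.rightDerived (n + 2)).obj S.X₁) := by
  let J := injectiveResolution S.X₃
  let K := (F.mapHomologicalComplex (ComplexShape.up ℕ)).obj J.cocomplex
  let K' := (F.mapHomologicalComplex (ComplexShape.up ℕ)).obj (spliceCocomplex J)
  let e : K.sc' n (n + 1) (n + 2) ≅ K'.sc' (n + 1) (n + 2) (n + 3) := Iso.refl _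
  exact ⟨J.isoRightDerivedObj F (n + 1) ≪≫
    ShortComplex.homologyMapIso (K.isoSc' n (n + 1) (n + 2) (by simp) (by simp) ≪≫ e ≪≫
      (K'.isoSc' (n + 1) (n + 2) (n + 3) (by simp) (by simp)).symm) ≪≫
    ((spliceResolution J hS).isoRightDerivedObj F (n + 2)).symm⟩

include hS in
theorem nonempty_cokernel_map_iso_rightDerived_one [PreservesFiniteLimits F] :
    Nonempty (cokernel (F.map S.g) ≅ (F.rightDerived 1).obj S.X₁) := by
  let J := injectiveResolution S.X₃
  let K := (F.mapHomologicalComplex (ComplexShape.up ℕ)).obj (spliceCocomplex J)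
  let A : ShortComplex D := ShortComplex.mk (F.map (S.g ≫ resolutionι J))
    (F.map (J.cocomplex.d 0 1))
    (by rw [← F.map_comp, g_comp_resolutionι_comp_d, F.map_zero])
  let e : A ≅ K.sc' 0 1 2 := Iso.refl _
  have h_exact : ((ShortComplex.mk _ _ (resolutionι_comp_d J)).map F).Exact :=
    (exact_resolutionι J).map_of_mono_of_preservesKernel F inferInstance inferInstance
  have : Mono ((ShortComplex.mk _ _ (resolutionι_comp_d J)).map F).f :=
    inferInstanceAs (Mono (F.map (resolutionι J)))
  have h_lift : h_exact.fIsKernel.lift (KernelFork.ofι A.f A.zero) = F.map S.g :=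
    (cancel_mono (F.map (resolutionι J))).1
      ((Fork.IsLimit.lift_ι h_exact.fIsKernel).trans (F.map_comp _ _))
  let h : A.LeftHomologyData :=
    { K := F.obj S.X₃
      H := cokernel (h_exact.fIsKernel.lift (KernelFork.ofι A.f A.zero))
      i := F.map (resolutionι J)
      π := cokernel.π _
      wi := ((ShortComplex.mk _ _ (resolutionι_comp_d J)).map F).zero
      hi := h_exact.fIsKernel
      wπ := cokernel.condition _
      hπ := cokernelIsCokernel _ }
  exact ⟨(cokernelIsoOfEq h_lift).symm ≪≫ h.homologyIso.symm ≪≫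
    ShortComplex.homologyMapIso (e ≪≫ (K.isoSc' 0 1 2 (by simp) (by simp)).symm) ≪≫
    ((spliceResolution J hS).isoRightDerivedObj F 1).symm⟩

theorem isDimensionShifting_rightDerived [PreservesFiniteLimits F] :
    IsDimensionShifting F.rightDerived where
  isZero_succ n X _ := F.isZero_rightDerived_obj_injective_succ n X
  nonempty_cokernel_iso {S} hS _ n := match n with
    | 0 => (nonempty_cokernel_map_iso_rightDerived_one hS F).map fun e =>
        cokernel.mapIso _ _ (F.rightDerivedZeroIsoSelf.app S.X₂)
          (F.rightDerivedZeroIsoSelf.app S.X₃) (F.rightDerivedZeroIsoSelf.hom.naturality S.g) ≪≫ e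
    | n + 1 => (nonempty_rightDerived_succ_succ_iso hS F n).map fun e =>
        cokernelIsoOfEq ((F.isZero_rightDerived_obj_injective_succ n S.X₂).eq_of_src _ 0) ≪≫
          cokernelZeroIsoTarget ≪≫ e

end RightDerived

section LeftDerived

variable {C D : Type*} [Category* C] [Category* D] [Abelian D]

theorem nonempty_cokernel_iso_of_forall_exact_of_forall_epi {F G H : C ⥤ D} (a : F ⟶ G)
    (b : G ⟶ H) (w : a ≫ b = 0)
    (h_exact : ∀ X, (ShortComplex.mk (a.app X) (b.app X) (congr_app w X)).Exact)
    (h_epi : ∀ X, Epi (b.app X)) : Nonempty (cokernel a ≅ H) := by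
  let S := ShortComplex.mk a b w
  have hS : S.Exact := S.exact_iff_isZero_homology.2 <| Functor.isZero _ fun X =>
    ((ShortComplex.exact_iff_isZero_homology _).1 (h_exact X)).of_iso
      (S.mapHomologyIso ((evaluation C D).obj X)).symm
  have : Epi S.g := NatTrans.epi_of_epi_app b
  exact ⟨(cokernelIsCokernel a).coconePointUniqueUpToIso hS.gIsCokernel⟩

variable [Abelian C] {F₁ F₂ F₃ : C ⥤ D} [F₁.Additive] [F₂.Additive] [F₃.Additive]
  {α : F₁ ⟶ F₂} {β : F₂ ⟶ F₃} (w : α ≫ β = 0)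

/-- The short complex of chain complexes `F₁(K) ⟶ F₂(K) ⟶ F₃(K)`. -/
noncomputable def mapChainComplexShortComplex (K : ChainComplex C ℕ) :
    ShortComplex (ChainComplex D ℕ) where
  X₁ := (F₁.mapHomologicalComplex _).obj K
  X₂ := (F₂.mapHomologicalComplex _).obj K
  X₃ := (F₃.mapHomologicalComplex _).obj K
  f := (NatTrans.mapHomologicalComplex α _).app K
  g := (NatTrans.mapHomologicalComplex β _).app K
  zero := by
    ext i
    exact congr_app w (K.X i)

/-- The morphism of short complexes of chain complexes induced by a chain map. -/
noncomputable def mapChainComplexShortComplexMap {K L : ChainComplex C ℕ} (φ : K ⟶ L) :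
    mapChainComplexShortComplex w K ⟶ mapChainComplexShortComplex w L where
  τ₁ := (F₁.mapHomologicalComplex _).map φ
  τ₂ := (F₂.mapHomologicalComplex _).map φ
  τ₃ := (F₃.mapHomologicalComplex _).map φ
  comm₁₂ := (NatTrans.mapHomologicalComplex α _).naturality φ
  comm₂₃ := (NatTrans.mapHomologicalComplex β _).naturality φ

variable (h : ∀ (P : C) [Projective P],
  (ShortComplex.mk (α.app P) (β.app P) (congr_app w P)).ShortExact)

include h in
theorem shortExact_mapChainComplexShortComplex {X : C} (P : ProjectiveResolution X) :
    (mapChainComplexShortComplex w P.complex).ShortExact :=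
  HomologicalComplex.shortExact_of_degreewise_shortExact _ fun i => h (P.complex.X i)

/-- The connecting morphism `Hₙ₊₁(F₃(P)) ⟶ Hₙ(F₁(P))` for a projective resolution `P`. -/
noncomputable def projectiveResolutionδ {X : C} (P : ProjectiveResolution X) (n : ℕ) :
    (HomologicalComplex.homologyFunctor D _ (n + 1)).obj
        ((F₃.mapHomologicalComplex (ComplexShape.down ℕ)).obj P.complex) ⟶
      (HomologicalComplex.homologyFunctor D _ n).obj
        ((F₁.mapHomologicalComplex (ComplexShape.down ℕ)).obj P.complex) :=
  (shortExact_mapChainComplexShortComplex w h P).δ (n + 1) n (by simp)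

theorem projectiveResolutionδ_naturality {X Y : C} (P : ProjectiveResolution X)
    (Q : ProjectiveResolution Y) (φ : P.complex ⟶ Q.complex) (n : ℕ) :
    projectiveResolutionδ w h P n ≫
        (F₁.mapHomologicalComplex _ ⋙ HomologicalComplex.homologyFunctor _ _ n).map φ =
      (F₃.mapHomologicalComplex _ ⋙ HomologicalComplex.homologyFunctor _ _ (n + 1)).map φ ≫
        projectiveResolutionδ w h Q n :=
  HomologicalComplex.HomologySequence.δ_naturality (mapChainComplexShortComplexMap w φ)
    (shortExact_mapChainComplexShortComplex w h P)
    (shortExact_mapChainComplexShortComplex w h Q) (n + 1) n (by simp)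

theorem projectiveResolutionδ_comp {X : C} (P : ProjectiveResolution X) (n : ℕ) :
    projectiveResolutionδ w h P n ≫ (HomologicalComplex.homologyFunctor D _ n).map
      ((NatTrans.mapHomologicalComplex α (ComplexShape.down ℕ)).app P.complex) = 0 :=
  (shortExact_mapChainComplexShortComplex w h P).δ_comp (n + 1) n (by simp)

theorem exact_projectiveResolutionδ {X : C} (P : ProjectiveResolution X) (n : ℕ) :
    (ShortComplex.mk _ _ (projectiveResolutionδ_comp w h P n)).Exact :=
  (shortExact_mapChainComplexShortComplex w h P).homology_exact₁ (n + 1) n (by simp)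

variable [HasProjectiveResolutions C]

/-- The connecting morphism of left derived functors attached to a sequence of functors
`F₁ ⟶ F₂ ⟶ F₃` which is short exact on projective objects. -/
noncomputable def leftDerivedδ (n : ℕ) : F₃.leftDerived (n + 1) ⟶ F₁.leftDerived n where
  app X := ((projectiveResolution X).isoLeftDerivedObj F₃ (n + 1)).hom ≫
    projectiveResolutionδ w h (projectiveResolution X) n ≫
    ((projectiveResolution X).isoLeftDerivedObj F₁ n).inv
  naturality X Y f := by
    let φ := ProjectiveResolution.lift f (projectiveResolution X) (projectiveResolution Y)
    have hφ := ProjectiveResolution.lift_commutes_zero f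
      (projectiveResolution X) (projectiveResolution Y)
    have h₁ := ProjectiveResolution.isoLeftDerivedObj_inv_naturality f _ _ φ hφ F₁ n
    have h₃ := ProjectiveResolution.isoLeftDerivedObj_hom_naturality f _ _ φ hφ F₃ (n + 1)
    rw [Category.assoc, Category.assoc, h₁, reassoc_of% h₃,
      ← reassoc_of% projectiveResolutionδ_naturality w h _ _ φ n]
    rfl

theorem leftDerivedδ_comp (n : ℕ) (X : C) :
    (leftDerivedδ w h n).app X ≫ (NatTrans.leftDerived α n).app X = 0 := by
  rw [(projectiveResolution X).leftDerived_app_eq α n]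
  simp only [leftDerivedδ, Category.assoc, Iso.inv_hom_id_assoc]
  rw [reassoc_of% projectiveResolutionδ_comp w h (projectiveResolution X) n]
  simp

theorem exact_leftDerivedδ (n : ℕ) (X : C) :
    (ShortComplex.mk _ _ (leftDerivedδ_comp w h n X)).Exact := by
  let P := projectiveResolution X
  refine (ShortComplex.exact_iff_of_iso ?_).2 (exact_projectiveResolutionδ w h P n)
  refine ShortComplex.isoMk (P.isoLeftDerivedObj F₃ (n + 1)) (P.isoLeftDerivedObj F₁ n)
    (P.isoLeftDerivedObj F₂ n) ?_ ?_
  · simp [leftDerivedδ, P]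
  · simp only [P.leftDerived_app_eq α n, Category.assoc, Iso.inv_hom_id, Category.comp_id]

theorem mono_leftDerivedδ (n : ℕ) (X : C) (hX : IsZero ((F₂.leftDerived (n + 1)).obj X)) :
    Mono ((leftDerivedδ w h n).app X) := by
  have : Mono (projectiveResolutionδ w h (projectiveResolution X) n) :=
    (shortExact_mapChainComplexShortComplex w h _).mono_δ _ _ _
      (hX.of_iso ((projectiveResolution X).isoLeftDerivedObj F₂ (n + 1)).symm)
  dsimp only [leftDerivedδ]
  infer_instance

end LeftDerived

section Ext

open Opposite

variable {R : Type*} [CommRing R] {C : Type*} [Category* C] [Abelian C] [Linear R C]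

/-- The functor `Hom(-, Y)` with values in `R`-modules, as a covariant functor to the opposite
category; `Extⁿ(-, Y)` is its `n`-th left derived functor. -/
noncomputable abbrev linearYonedaRightOp (R : Type u) [CommRing R] [Linear R C] (Y : C) :
    C ⥤ (ModuleCat R)ᵒᵖ :=
  ((linearYoneda R C).obj Y).rightOp

/-- The map `Hom(-, X) ⟶ Hom(-, Y)` induced by `X ⟶ Y`, as a morphism in the opposite direction
between functors to the opposite category. -/
noncomputable abbrev linearYonedaRightOpMap (R : Type u) [CommRing R] [Linear R C] {X Y : C}
    (f : X ⟶ Y) : linearYonedaRightOp R Y ⟶ linearYonedaRightOp R X :=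
  NatTrans.rightOp ((linearYoneda R C).map f)

theorem linearYonedaRightOpMap_g_comp_f {S : ShortComplex C} :
    linearYonedaRightOpMap R S.g ≫ linearYonedaRightOpMap R S.f = 0 := by
  ext X
  refine Quiver.Hom.unop_inj ?_
  ext (φ : X ⟶ S.X₁)
  change (φ ≫ S.f) ≫ S.g = 0
  simp

theorem shortExact_linearYonedaRightOp {S : ShortComplex C} (hS : S.ShortExact) (P : C)
    [Projective P] :
    (ShortComplex.mk ((linearYonedaRightOpMap R S.g).app P) ((linearYonedaRightOpMap R S.f).app P)
      (congr_app (linearYonedaRightOpMap_g_comp_f (R := R)) P)).ShortExact := by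
  let A : ShortComplex (ModuleCat R) := ShortComplex.mk
    (((linearYoneda R C).map S.f).app (op P)) (((linearYoneda R C).map S.g).app (op P))
    (by ext (φ : P ⟶ S.X₁); change (φ ≫ S.f) ≫ S.g = 0; simp)
  have := hS.mono_f
  have := hS.epi_g
  have hA : A.ShortExact :=
    { exact := (ShortComplex.moduleCat_exact_iff _).2 fun (φ : P ⟶ S.X₂) (hφ : φ ≫ S.g = 0) =>
        ⟨hS.exact.lift φ hφ, hS.exact.lift_f φ hφ⟩
      mono_f := (ModuleCat.mono_iff_injective _).2 fun (φ ψ : P ⟶ S.X₁)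
        (h : φ ≫ S.f = ψ ≫ S.f) => (cancel_mono S.f).1 h
      epi_g := (ModuleCat.epi_iff_surjective _).2 fun (φ : P ⟶ S.X₃) =>
        ⟨Projective.factorThru φ S.g, Projective.factorThru_comp φ S.g⟩ }
  exact hA.op

variable [EnoughProjectives C]

theorem isZero_Ext_succ_of_injective (X Y : C) [Injective Y] (n : ℕ) :
    IsZero (((Ext R C (n + 1)).obj (op X)).obj Y) := by
  let P := projectiveResolution X
  refine IsZero.of_iso ?_ (P.isoExt (n + 1) Y)
  rw [← HomologicalComplex.exactAt_iff_isZero_homology,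
    HomologicalComplex.exactAt_iff' _ n (n + 1) (n + 2) (by simp) (by simp),
    ShortComplex.moduleCat_exact_iff]
  intro (f : P.complex.X (n + 1) ⟶ Y) (hf : P.complex.d (n + 2) (n + 1) ≫ f = 0)
  exact ⟨(P.exact_succ n).descToInjective f hf, (P.exact_succ n).comp_descToInjective f hf⟩

variable {S : ShortComplex C} (hS : S.ShortExact)

/-- The connecting morphism `Extⁿ(-, X₃) ⟶ Extⁿ⁺¹(-, X₁)` of a short exact sequence
`0 ⟶ X₁ ⟶ X₂ ⟶ X₃ ⟶ 0`. -/
noncomputable def extδ (n : ℕ) : (Ext R C n).flip.obj S.X₃ ⟶ (Ext R C (n + 1)).flip.obj S.X₁ :=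
  NatTrans.leftOp (leftDerivedδ linearYonedaRightOpMap_g_comp_f
    (fun P _ => shortExact_linearYonedaRightOp hS P) n)

theorem map_comp_extδ (n : ℕ) : (Ext R C n).flip.map S.g ≫ extδ hS n = 0 := by
  ext X : 2
  exact congrArg Quiver.Hom.unop (leftDerivedδ_comp linearYonedaRightOpMap_g_comp_f
    (fun P _ => shortExact_linearYonedaRightOp hS P) n X.unop)

theorem exact_extδ (n : ℕ) (X : Cᵒᵖ) :
    (ShortComplex.mk (((Ext R C n).flip.map S.g).app X) ((extδ hS n).app X)
      (congr_app (map_comp_extδ hS n) X)).Exact :=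
  (exact_leftDerivedδ linearYonedaRightOpMap_g_comp_f
    (fun P _ => shortExact_linearYonedaRightOp hS P) n X.unop).unop

theorem epi_extδ [Injective S.X₂] (n : ℕ) (X : Cᵒᵖ) : Epi ((extδ (R := R) hS n).app X) := by
  have := mono_leftDerivedδ linearYonedaRightOpMap_g_comp_f
    (fun P _ => shortExact_linearYonedaRightOp (R := R) hS P) n X.unop
    (isZero_Ext_succ_of_injective X.unop S.X₂ n).op
  exact unop_epi_of_mono ((leftDerivedδ linearYonedaRightOpMap_g_comp_f
    (fun P _ => shortExact_linearYonedaRightOp (R := R) hS P) n).app X.unop)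

theorem isDimensionShifting_flip_Ext : IsDimensionShifting fun n => (Ext R C n).flip where
  isZero_succ n Y _ := Functor.isZero _ fun X => isZero_Ext_succ_of_injective X.unop Y n
  nonempty_cokernel_iso hS _ n := nonempty_cokernel_iso_of_forall_exact_of_forall_epi _ _
    (map_comp_extδ hS n) (exact_extδ hS n) (epi_extδ hS n)

end Ext

section LocalCohomology

open Opposite localCohomology

variable {R : Type u} [CommRing R]

instance preservesColimitsOfShape_forget_moduleCat {J : Type} [SmallCategory J] [IsFiltered J] :
    PreservesColimitsOfShape J (forget (ModuleCat.{u} R)) :=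
  (preservesSmallestFilteredColimits_of_preservesFilteredColimits
    (forget (ModuleCat.{u} R))).preserves_filtered_colimits J

instance preservesFiniteLimits_linearYoneda_obj (Y : ModuleCat.{u} R) :
    PreservesFiniteLimits ((linearYoneda R (ModuleCat.{u} R)).obj Y) where
  preservesFiniteLimits J _ _ :=
    have : PreservesLimitsOfShape J
        ((linearYoneda R (ModuleCat.{u} R)).obj Y ⋙ forget (ModuleCat.{u} R)) :=
      inferInstanceAs (PreservesLimitsOfShape J (yoneda.obj Y))
    preservesLimitsOfShape_of_reflects_of_preserves _ (forget (ModuleCat.{u} R))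

/-- `Ext⁰(-, Y)` is `Hom(-, Y)`. -/
noncomputable def extZeroIso (Y : ModuleCat.{u} R) :
    (Ext R (ModuleCat.{u} R) 0).flip.obj Y ≅ (linearYoneda R (ModuleCat.{u} R)).obj Y :=
  have : PreservesFiniteColimits (linearYonedaRightOp R Y) := preservesFiniteColimits_rightOp _
  ((Functor.leftOpRightOpEquiv _ _).inverse.mapIso
    (Functor.leftDerivedZeroIsoSelf (linearYonedaRightOp R Y))).unop.symm

variable (𝔞 : Ideal R)

/-- The inverse system `R / 𝔞ⁿ`. -/
abbrev quotientPowers : (ℕᵒᵖ)ᵒᵖ ⥤ (ModuleCat.{u} R)ᵒᵖ :=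
  (ringModIdeals (idealPowersDiagram 𝔞)).op

/-- The functor sending `F : (ModuleCat R)ᵒᵖ ⥤ ModuleCat R` to the colimit of the `F(R / 𝔞ⁿ)`. -/
noncomputable abbrev colimitQuotientPowers :
    ((ModuleCat.{u} R)ᵒᵖ ⥤ ModuleCat.{u} R) ⥤ ModuleCat.{u} R :=
  (Functor.whiskeringLeft _ _ _).obj (quotientPowers 𝔞) ⋙ colim

instance : PreservesFiniteColimits (colimitQuotientPowers 𝔞) :=
  comp_preservesFiniteColimits _ _

/-- `Hⁱ_𝔞` is the colimit of the `Extⁱ(R / 𝔞ⁿ, -)`, with the colimit taken as a functor applied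
to `Extⁱ(-, M)` so that its right exactness gives dimension shifting. -/
noncomputable def localCohomologyIso (i : ℕ) :
    (Ext R (ModuleCat.{u} R) i).flip ⋙ colimitQuotientPowers 𝔞 ≅ localCohomology 𝔞 i :=
  (colimitIsoFlipCompColim (diagram (idealPowersDiagram 𝔞) i)).symm

theorem isDimensionShifting_localCohomology : IsDimensionShifting (localCohomology 𝔞) :=
  (isDimensionShifting_flip_Ext.comp (colimitQuotientPowers 𝔞)).of_iso (localCohomologyIso 𝔞)

theorem map_mk_one_mem_torsion_powers {M : Type u} [AddCommGroup M] [Module R M] (n : ℕ)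
    (ψ : (R ⧸ 𝔞 ^ n) →ₗ[R] M) :
    ψ (Submodule.Quotient.mk 1) ∈ (SystemOfIdeals.powers 𝔞).torsion M := by
  refine ⟨𝔞 ^ n, ⟨n, rfl⟩, fun r hr => ?_⟩
  rw [← map_smul, ← Submodule.Quotient.mk_smul, (Submodule.Quotient.mk_eq_zero _).2, map_zero]
  exact Ideal.mul_mem_right _ _ hr

/-- The maps `Hom(R / 𝔞ⁿ, M) ⟶ Γ_𝔞(M)` given by evaluation at `1`. -/
def evalOneCocone (M : ModuleCat.{u} R) :
    Cocone (quotientPowers 𝔞 ⋙ (linearYoneda R (ModuleCat.{u} R)).obj M) where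
  pt := (SystemOfIdeals.powers 𝔞).torsionFunctor.obj M
  ι :=
    { app n := ModuleCat.ofHom
        { toFun := fun (φ : (ringModIdeals (idealPowersDiagram 𝔞)).obj n.unop ⟶ M) =>
            ⟨φ.hom (Submodule.Quotient.mk (p := 𝔞 ^ n.unop.unop) 1),
              map_mk_one_mem_torsion_powers 𝔞 n.unop.unop φ.hom⟩
          map_add' := fun _ _ => rfl
          map_smul' := fun _ _ => rfl }
      naturality _ _ _ := rfl }

variable (M : ModuleCat.{u} R)

theorem injective_desc_evalOneCocone :
    Function.Injective (colimit.desc _ (evalOneCocone 𝔞 M)).hom := by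
  refine (injective_iff_map_eq_zero _).2 fun x hx => ?_
  obtain ⟨n, φ, rfl⟩ := Concrete.colimit_exists_rep _ x
  have h_eval : ((evalOneCocone 𝔞 M).ι.app n).hom φ = 0 := by
    rw [← colimit.ι_desc]
    exact hx
  have hφ : φ = 0 :=
    ModuleCat.hom_ext (Submodule.linearMap_qext _ (LinearMap.ext_ring (Subtype.ext_iff.1 h_eval)))
  rw [hφ]
  exact map_zero (colimit.ι (quotientPowers 𝔞 ⋙ (linearYoneda R (ModuleCat.{u} R)).obj M) n).hom

theorem surjective_desc_evalOneCocone :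
    Function.Surjective (colimit.desc _ (evalOneCocone 𝔞 M)).hom := by
  rintro ⟨x, _, ⟨n, rfl⟩, hx⟩
  let φ : (ringModIdeals (idealPowersDiagram 𝔞)).obj (op n) ⟶ M := ModuleCat.ofHom
    (Submodule.liftQ (𝔞 ^ n) (LinearMap.toSpanSingleton R M x) hx)
  refine ⟨(colimit.ι (quotientPowers 𝔞 ⋙ (linearYoneda R (ModuleCat.{u} R)).obj M)
    (op (op n))).hom φ, ?_⟩
  refine (congrArg (fun g => g.hom φ)
    (colimit.ι_desc (evalOneCocone 𝔞 M) (op (op n)))).trans ?_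
  exact Subtype.ext (one_smul R x)

theorem nonempty_localCohomology_zero_iso :
    Nonempty ((localCohomology 𝔞 0).obj M ≅ (SystemOfIdeals.powers 𝔞).torsionFunctor.obj M) :=
  ⟨((localCohomologyIso 𝔞 0).app M).symm ≪≫
    (colimitQuotientPowers 𝔞).mapIso (extZeroIso M) ≪≫
    (LinearEquiv.ofBijective _ ⟨injective_desc_evalOneCocone 𝔞 M,
      surjective_desc_evalOneCocone 𝔞 M⟩).toModuleIso⟩

end LocalCohomology

section Comparison

variable {R : Type u} [CommRing R] [IsNoetherianRing R] (Φ Ψ : SystemOfIdeals R)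
  (M : ModuleCat.{u} R)

theorem torsionModules_localCohomology_zero_iff_torsion_le :
    Ψ.torsionModules ((Φ.localCohomology 0).obj M) ↔ Φ.torsion M ≤ Ψ.torsion M :=
  (Ψ.torsionModules.prop_iff_of_iso (Φ.torsionFunctor.rightDerivedZeroIsoSelf.app M)).trans
    SystemOfIdeals.torsionModules_torsionFunctor_obj_iff

theorem torsionModules_localCohomology_zero_iff :
    Ψ.torsionModules ((Φ.localCohomology 0).obj M) ↔
      ∀ 𝔞 ∈ Φ, Ψ.torsionModules ((localCohomology 𝔞 0).obj M) := by
  have h_powers (𝔞 : Ideal R) :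
      Ψ.torsionModules ((localCohomology 𝔞 0).obj M) ↔
        (SystemOfIdeals.powers 𝔞).torsion M ≤ Ψ.torsion M :=
    ((nonempty_localCohomology_zero_iso 𝔞 M).elim Ψ.torsionModules.prop_iff_of_iso).trans
      SystemOfIdeals.torsionModules_torsionFunctor_obj_iff
  simp only [torsionModules_localCohomology_zero_iff_torsion_le, h_powers,
    Φ.torsion_eq_iSup_powers, iSup₂_le_iff]

theorem torsionModules_localCohomology_iff (t : ℕ) :
    (∀ i < t, Ψ.torsionModules ((Φ.localCohomology i).obj M)) ↔
      ∀ i < t, ∀ 𝔞 ∈ Φ, Ψ.torsionModules ((localCohomology 𝔞 i).obj M) := by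
  have h_zero (X : ModuleCat.{u} R) : Ψ.torsionModules ((Φ.localCohomology 0).obj X) ↔
      ∀ 𝔞 : {𝔞 // 𝔞 ∈ Φ}, Ψ.torsionModules ((localCohomology 𝔞.1 0).obj X) := by
    rw [torsionModules_localCohomology_zero_iff, Subtype.forall]
  have h_mono (X : ModuleCat.{u} R) (hX : Ψ.torsionModules ((Φ.localCohomology 0).obj X)) :
      ∃ (E : ModuleCat.{u} R) (f : X ⟶ E), Mono f ∧ Injective E ∧
        Ψ.torsionModules ((Φ.localCohomology 0).obj E) := by
    simp only [torsionModules_localCohomology_zero_iff_torsion_le] at hX ⊢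
    exact SystemOfIdeals.exists_mono_injective_torsion_le hX
  exact ((isDimensionShifting_rightDerived Φ.torsionFunctor).forall_lt_prop_iff
    (fun 𝔞 : {𝔞 // 𝔞 ∈ Φ} => isDimensionShifting_localCohomology 𝔞.1) h_zero h_mono t M).trans
    (forall₂_congr fun _ _ => Subtype.forall)

end Comparison

theorem corollary2p14 {R : Type u} [CommRing R] [IsNoetherianRing R]
    (Φ : SystemOfIdeals R) (M : ModuleCat.{u} R) (k : ℤ) :
    (∀ t : ℕ,
      (∀ i < t, dimLE R k ((Φ.localCohomology i).obj M)) ↔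
        (∀ i < t, ∀ 𝔞 ∈ Φ, dimLE R k ((localCohomology 𝔞 i).obj M))) ∧
    ((∀ i : ℕ, dimLE R k ((Φ.localCohomology i).obj M)) ↔
      (∀ i : ℕ, ∀ 𝔞 ∈ Φ, dimLE R k ((localCohomology 𝔞 i).obj M))) := by
  have key (t : ℕ) : (∀ i < t, dimLE R k ((Φ.localCohomology i).obj M)) ↔
      (∀ i < t, ∀ 𝔞 ∈ Φ, dimLE R k ((localCohomology 𝔞 i).obj M)) := by
    simp only [dimLE_iff_torsionModules]
    obtain ⟨𝔞, h𝔞⟩ := Φ.nonempty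
    by_cases hk : -1 ≤ k
    · simp only [hk, true_and]
      exact torsionModules_localCohomology_iff Φ _ M t
    · simp only [hk, false_and]
      exact ⟨fun h i hi => (h i hi).elim, fun h i hi => h i hi 𝔞 h𝔞⟩
  refine ⟨key, fun h i => ?_, fun h i => ?_⟩
  · exact (key (i + 1)).1 (fun j _ => h j) i i.lt_succ_self
  · exact (key (i + 1)).2 (fun j _ => h j) i i.lt_succ_self
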